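/- **Theorem (Head Effect in the Dynamic Model).** Let $N$ streamers share a fixed pool of $M>0$ viewers. At time $t\ge 0$ streamer $i$ has audience $n_i(t)$ and content quality $q_i(t)$, where $q_i(t)$ lies in a fixed set $Q\subseteq\mathbb R$, and $$\dot n_i=\gamma\,[M P_i-n_i],\qquad \dot q_i=\eta_i\Big[(1-\tau)R\,\frac{\partial (M P_i)}{\partial q_i}-c'(q_i)\Big],\qquad P_i=\frac{\exp(\alpha_i q_i-p_i+\beta n_i)}{\sum_{k=1}^N\exp(\alpha_k q_k-p_k+\beta n_k)},$$ the partial derivative being taken with all other arguments of $P_i$ fixed. Here $\gamma,R,\alpha_i,\eta_i>0$, $0\le\tau\le1$, $p_i\in\mathbb R$; $Q$ is convex, and the cost $c$ is differentiable, strictly increasing and convex on $Q$. Initially $n_i(0)\ge0$ and $\sum_i n_i(0)=M$. Let the streamers be identical: $\alpha_i=\alpha$, $p_i=p$, $\eta_i=\eta$ and $q_i(0)=q_0$ for all $i$. Put $s_i=n_i/M$ and $\mathrm{HHI}=\sum_{i=1}^N s_i^2$. Then for every $\varepsilon>0$ there is $\beta_0>0$, independent of $q_0$ and of the initial audiences,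 such that for every $\beta\ge\beta_0$ and every solution on $[0,\infty)$: 1. If streamer $i$ has strictly the largest initial audience, $n_i(0)>n_j(0)$ for all $j\ne i$, by however small a margin, then for all sufficiently large $t$ $$|s_i(t)-1|<\varepsilon,\qquad |s_j(t)|<\varepsilon\ (j\ne i),\qquad |\mathrm{HHI}(t)-1|<\varepsilon .$$ 2. If the initial audiences are random and $\Pr[n_i(0)=n_j(0)]=0$ for all $i\neq j$, then almost surely there is a streamer $i$ with strictly the largest initial audience, and the conclusion of 1 holds for it. -/

import Mathlib

/-- A live streaming platform with `N` streamers, all data except the network-effect parameter `β`.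
`Q` is the range of admissible content qualities, for instance `Set.Ici 0` or `Set.univ`. -/
structure StreamingMarket (N : ℕ) where
  /-- total number of viewers -/
  M : ℝ
  /-- adjustment rate of the viewers -/
  γ : ℝ
  /-- average revenue per viewer -/
  R : ℝ
  /-- commission rate of the platform -/
  τ : ℝ
  /-- intrinsic attractiveness of each streamer -/
  α : Fin N → ℝ
  /-- price of each streamer -/
  p : Fin N → ℝ
  /-- speed at which each streamer adjusts content quality -/
  η : Fin N → ℝ
  /-- range of admissible qualities -/
  Q : Set ℝ
  /-- cost of quality -/
  c : ℝ → ℝ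
  M_pos : 0 < M
  γ_pos : 0 < γ
  R_pos : 0 < R
  τ_nonneg : 0 ≤ τ
  τ_le_one : τ ≤ 1
  α_pos : ∀ i, 0 < α i
  η_pos : ∀ i, 0 < η i
  c_convex : ConvexOn ℝ Q c
  c_strictMono : StrictMonoOn c Q
  c_differentiable : ∀ x ∈ Q, DifferentiableAt ℝ c x

namespace StreamingMarket

variable {N : ℕ}

/-- The streamers have identical intrinsic characteristics. -/
def Identical (mkt : StreamingMarket N) : Prop :=
  (∀ i j, mkt.α i = mkt.α j) ∧ (∀ i j, mkt.p i = mkt.p j) ∧ (∀ i j, mkt.η i = mkt.η j)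

/-- Deterministic part of a viewer's utility, `α_i q_i - p_i + β n_i`. -/
def utility (mkt : StreamingMarket N) (β : ℝ) (q n : Fin N → ℝ) (i : Fin N) : ℝ :=
  mkt.α i * q i - mkt.p i + β * n i

/-- Multinomial logit probability that a viewer chooses streamer `i`. -/
noncomputable def choiceProb (mkt : StreamingMarket N) (β : ℝ) (q n : Fin N → ℝ) (i : Fin N) : ℝ :=
  Real.exp (mkt.utility β q n i) / ∑ k, Real.exp (mkt.utility β q n k)

/-- The marginal audience `∂n_i/∂q_i`: the derivative of the expected audience `M P_i` in the
quality `q_i`, all the other arguments of `P_i` being held fixed. -/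
noncomputable def marginalAudience (mkt : StreamingMarket N) (β : ℝ) (q n : Fin N → ℝ)
    (i : Fin N) : ℝ :=
  deriv (fun x : ℝ => mkt.M * mkt.choiceProb β (Function.update q i x) n i) (q i)

/-- `n t i` and `q t i` are the audience and the quality of streamer `i` at time `t ≥ 0`; they solve
the viewer and the quality equations, and the `M` viewers are distributed among the streamers at
time `0`. -/
structure IsTrajectory (mkt : StreamingMarket N) (β : ℝ) (n q : ℝ → Fin N → ℝ) : Prop where
  initial_nonneg : ∀ i, 0 ≤ n 0 i
  initial_sum : ∑ i, n 0 i = mkt.M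
  quality_mem : ∀ t, 0 ≤ t → ∀ i, q t i ∈ mkt.Q
  viewer_eq : ∀ t, 0 ≤ t → ∀ i,
    HasDerivWithinAt (fun s => n s i)
      (mkt.γ * (mkt.M * mkt.choiceProb β (q t) (n t) i - n t i)) (Set.Ici 0) t
  quality_eq : ∀ t, 0 ≤ t → ∀ i,
    HasDerivWithinAt (fun s => q s i)
      (mkt.η i * ((1 - mkt.τ) * mkt.R * mkt.marginalAudience β (q t) (n t) i
        - deriv mkt.c (q t i))) (Set.Ici 0) t

/-- Market share of streamer `i`. -/
noncomputable def share (mkt : StreamingMarket N) (n : Fin N → ℝ) (i : Fin N) : ℝ :=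
  n i / mkt.M

/-- Herfindahl-Hirschman index. -/
noncomputable def hhi (mkt : StreamingMarket N) (n : Fin N → ℝ) : ℝ :=
  ∑ i, mkt.share n i ^ 2

/-- Streamer `i` dominates up to `ε`: its share is within `ε` of `1`, every other share is within
`ε` of `0`, and the Herfindahl-Hirschman index is within `ε` of `1`. -/
def Dominates (mkt : StreamingMarket N) (ε : ℝ) (n : Fin N → ℝ) (i : Fin N) : Prop :=
  |mkt.share n i - 1| < ε ∧ (∀ j, j ≠ i → |mkt.share n j| < ε) ∧ |mkt.hhi n - 1| < ε

end StreamingMarket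

/-!
While a streamer `i` is at least as attractive as a rival `j`, the gap `n_i - n_j` decays at most
exponentially, hence stays positive, and the quality gap `q_i - q_j` cannot become negative: the
cost is convex and the marginal audience `M α P (1 - P)` is larger for `i`. So the first time at
which `j` would become as attractive as `i` never comes, and the initial leader leads forever.

The leader then satisfies `P_i ≥ 1 / N`, and `P_j ≤ P_i exp (-β (n_i - n_j))`. When `β` is large,
the gap `n_i - n_j` grows exponentially as long as it is below `M / (2N)`, however small it was
initially. Once all the gaps have passed that level, `P_i` is within `N exp (-β M / (2N))` of `1`,
and the audience of `i` relaxes towards `M P_i`.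
-/

open Set Filter Topology

section DifferentialInequalities

variable {f f' : ℝ → ℝ} {a b c κ : ℝ}

theorem pos_of_forall_pos_before (hf : ContinuousOn f (Icc a b))
    (h : ∀ T ∈ Icc a b, (∀ t ∈ Ico a T, 0 < f t) → 0 < f T) : ∀ t ∈ Icc a b, 0 < f t := by
  by_contra! hex
  have hclosed : IsClosed (Icc a b ∩ f ⁻¹' Iic 0) :=
    hf.preimage_isClosed_of_isClosed isClosed_Icc isClosed_Iic
  obtain ⟨T, ⟨hT, hfT⟩, hleast⟩ :=
    (isCompact_Icc.of_isClosed_subset hclosed inter_subset_left).exists_isLeast hex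
  refine (h T hT fun t ht => ?_).not_ge hfT
  by_contra! hft
  exact ht.2.not_ge (hleast ⟨⟨ht.1, ht.2.le.trans hT.2⟩, hft⟩)

theorem nonneg_of_deriv_right_nonneg_of_neg (hf : ContinuousOn f (Icc a b))
    (hf' : ∀ t ∈ Ico a b, HasDerivWithinAt f (f' t) (Ici t) t) (ha : 0 ≤ f a)
    (h : ∀ t ∈ Ico a b, f t < 0 → 0 ≤ f' t) : ∀ t ∈ Icc a b, 0 ≤ f t := by
  intro t ht
  -- `f` cannot cross the line `-δ (1 + s - a)`, on which it is negative.
  have hfence : ∀ δ > 0, -f t ≤ δ * (1 + t - a) := by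
    intro δ hδ
    refine image_le_of_deriv_right_lt_deriv_boundary (f := fun s => -f s) (f' := fun s => -f' s)
      (B := fun s => δ * (1 + s - a)) (B' := fun _ => δ) hf.fun_neg
      (fun s hs => (hf' s hs).fun_neg) ?_ (fun s => ?_) (fun s hs heq => ?_) ht
    · simp only [add_sub_cancel_right, mul_one]
      linarith
    · simpa using (((hasDerivAt_id s).const_add 1).sub_const a).const_mul δ
    · have hline : 0 < δ * (1 + s - a) := mul_pos hδ (by linarith [hs.1])
      have hneg : f s < 0 := by linarith
      exact (neg_nonpos.2 (h s hs hneg)).trans_lt hδ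
  have hlength : 0 < 1 + t - a := by linarith [ht.1]
  refine neg_nonpos.1 (le_of_forall_pos_le_add fun δ hδ => ?_)
  rw [zero_add, ← div_mul_cancel₀ δ hlength.ne']
  exact hfence _ (div_pos hδ hlength)

theorem mul_exp_le_of_mul_le_deriv_right (hf : ContinuousOn f (Icc a b))
    (hf' : ∀ t ∈ Ico a b, HasDerivWithinAt f (f' t) (Ici t) t)
    (h : ∀ t ∈ Ico a b, κ * f t ≤ f' t) :
    ∀ t ∈ Icc a b, f a * Real.exp (κ * (t - a)) ≤ f t := by
  intro t ht
  have hgronwall := le_gronwallBound_of_liminf_deriv_right_le (f := -f) (f' := -f') (δ := -f a)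
    (K := κ) (ε := 0) hf.neg (fun s hs _ hr => (hf' s hs).neg.liminf_right_slope_le hr) le_rfl
    (fun s hs => by simpa using h s hs) t ht
  simpa [gronwallBound_ε0] using hgronwall

theorem eventually_lt_of_relaxation {d : ℝ} (hf : ContinuousOn f (Ici a))
    (hf' : ∀ t ∈ Ici a, HasDerivWithinAt f (f' t) (Ici t) t) (hκ : 0 < κ) (hd : d < c)
    (h : ∀ᶠ t in atTop, κ * (c - f t) ≤ f' t) : ∀ᶠ t in atTop, d < f t := by
  obtain ⟨T, hT⟩ := (h.and (eventually_ge_atTop a)).exists_forall_of_atTop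
  have haT : a ≤ T := (hT T le_rfl).2
  have hlim : Tendsto (fun t => c + (f T - c) * Real.exp (-κ * (t - T))) atTop (𝓝 c) := by
    have hexponent : Tendsto (fun t => κ * (t - T)) atTop atTop :=
      (tendsto_atTop_add_const_right _ (-T) tendsto_id).const_mul_atTop hκ
    simpa using
      ((Real.tendsto_exp_neg_atTop_nhds_zero.comp hexponent).const_mul (f T - c)).const_add c
  filter_upwards [hlim.eventually_const_lt hd, eventually_ge_atTop T] with t hdt hTt
  have hbound := mul_exp_le_of_mul_le_deriv_right (f := fun s => f s - c) (κ := -κ)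
    ((hf.mono fun s hs => haT.trans hs.1).sub continuousOn_const)
    (fun s hs => (hf' s (haT.trans hs.1)).sub_const c)
    (fun s hs => by linarith [(hT s hs.1).1]) t (right_mem_Icc.2 hTt)
  linarith

theorem eventually_ge_of_exponential_growth_below (hf : ContinuousOn f (Ici a))
    (hf' : ∀ t ∈ Ici a, HasDerivWithinAt f (f' t) (Ici t) t) (hκ : 0 < κ)
    (hpos : ∀ t ∈ Ici a, 0 < f t) (h : ∀ t ∈ Ici a, f t < c → κ * f t ≤ f' t) :
    ∀ᶠ t in atTop, c ≤ f t := by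
  have hstays : ∀ s t, a ≤ s → s ≤ t → c ≤ f s → c ≤ f t := fun s t has hst hcs => by
    refine sub_nonneg.1 (nonneg_of_deriv_right_nonneg_of_neg (f := fun r => f r - c)
      ((hf.mono fun r hr => has.trans hr.1).sub continuousOn_const)
      (fun r hr => (hf' r (has.trans hr.1)).sub_const c) (sub_nonneg.2 hcs)
      (fun r hr hneg => ?_) t (right_mem_Icc.2 hst))
    have har : a ≤ r := has.trans hr.1
    exact (mul_pos hκ (hpos r har)).le.trans (h r har (sub_neg.1 hneg))
  have hlim : Tendsto (fun t => f a * Real.exp (κ * (t - a))) atTop atTop :=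
    (Real.tendsto_exp_atTop.comp ((tendsto_atTop_add_const_right _ (-a) tendsto_id).const_mul_atTop
      hκ)).const_mul_atTop (hpos a self_mem_Ici)
  filter_upwards [hlim.eventually_ge_atTop c, eventually_ge_atTop a] with t hct hat
  by_contra! hlt
  have hbelow : ∀ s ∈ Ico a t, f s < c := fun s hs => by
    by_contra! hcs
    exact hlt.not_ge (hstays s t hs.1 hs.2.le hcs)
  have hgrowth := mul_exp_le_of_mul_le_deriv_right (hf.mono Icc_subset_Ici_self)
    (fun s hs => hf' s hs.1) (fun s hs => h s hs.1 (hbelow s hs)) t (right_mem_Icc.2 hat)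
  exact hlt.not_ge (hct.trans hgrowth)

end DifferentialInequalities

section Softmax

variable {ι : Type*} [Fintype ι] {u : ι → ℝ} {i j : ι} {z : ℝ}

/-- The softmax function: the logit choice probabilities of alternatives with utilities `u`. -/
noncomputable def softmax (u : ι → ℝ) (i : ι) : ℝ :=
  Real.exp (u i) / ∑ k, Real.exp (u k)

theorem sum_exp_pos [Nonempty ι] (u : ι → ℝ) : 0 < ∑ k, Real.exp (u k) :=
  Finset.sum_pos (fun _ _ => Real.exp_pos _) Finset.univ_nonempty

theorem softmax_pos (u : ι → ℝ) (i : ι) : 0 < softmax u i :=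
  have : Nonempty ι := ⟨i⟩
  div_pos (Real.exp_pos _) (sum_exp_pos u)

theorem sum_softmax [Nonempty ι] (u : ι → ℝ) : ∑ i, softmax u i = 1 := by
  simp only [softmax]
  rw [← Finset.sum_div, div_self (sum_exp_pos u).ne']

theorem softmax_le_one (u : ι → ℝ) (i : ι) : softmax u i ≤ 1 := by
  have : Nonempty ι := ⟨i⟩
  rw [← sum_softmax u]
  exact Finset.single_le_sum (fun k _ => (softmax_pos u k).le) (Finset.mem_univ i)

theorem softmax_add_softmax_le_one (u : ι → ℝ) (hij : i ≠ j) : softmax u i + softmax u j ≤ 1 := by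
  have : Nonempty ι := ⟨i⟩
  rw [← sum_softmax u]
  exact Finset.add_le_sum (fun k _ => (softmax_pos u k).le) (Finset.mem_univ i) (Finset.mem_univ j)
    hij

theorem softmax_le_softmax (h : u j ≤ u i) : softmax u j ≤ softmax u i :=
  div_le_div_of_nonneg_right (Real.exp_le_exp.2 h)
    (Finset.sum_nonneg fun _ _ => (Real.exp_pos _).le)

theorem softmax_eq_mul_exp_sub (u : ι → ℝ) (i j : ι) :
    softmax u j = softmax u i * Real.exp (u j - u i) := by
  simp only [softmax]
  rw [div_mul_eq_mul_div, ← Real.exp_add, add_sub_cancel]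

theorem softmax_le_mul_exp_neg (h : z ≤ u i - u j) : softmax u j ≤ softmax u i * Real.exp (-z) := by
  rw [softmax_eq_mul_exp_sub u i j]
  exact mul_le_mul_of_nonneg_left (Real.exp_le_exp.2 (by linarith)) (softmax_pos u i).le

theorem softmax_mul_one_sub_le (h : u j ≤ u i) :
    softmax u j * (1 - softmax u j) ≤ softmax u i * (1 - softmax u i) := by
  rcases eq_or_ne i j with rfl | hij
  · rfl
  have hfactor := mul_nonneg (sub_nonneg.2 (softmax_le_softmax h))
    (sub_nonneg.2 (softmax_add_softmax_le_one u hij))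
  linarith

theorem inv_card_le_softmax (h : ∀ k, u k ≤ u i) : (Fintype.card ι : ℝ)⁻¹ ≤ softmax u i := by
  have : Nonempty ι := ⟨i⟩
  have hsum : ∑ k, softmax u k ≤ Fintype.card ι * softmax u i := by
    simpa using Finset.sum_le_card_nsmul Finset.univ _ _ fun k _ => softmax_le_softmax (h k)
  rw [sum_softmax] at hsum
  exact (inv_le_iff_one_le_mul₀' (by positivity)).2 hsum

theorem one_sub_card_mul_exp_neg_le_softmax (h : ∀ k, k ≠ i → z ≤ u i - u k) :
    1 - Fintype.card ι * Real.exp (-z) ≤ softmax u i := by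
  classical
  have : Nonempty ι := ⟨i⟩
  have hrival : ∀ k ∈ Finset.univ.erase i, softmax u k ≤ Real.exp (-z) := fun k hk =>
    (softmax_le_mul_exp_neg (h k (Finset.ne_of_mem_erase hk))).trans
      (mul_le_of_le_one_left (Real.exp_pos _).le (softmax_le_one u i))
  have hrivals : ∑ k ∈ Finset.univ.erase i, softmax u k ≤ Fintype.card ι * Real.exp (-z) := by
    refine (Finset.sum_le_card_nsmul _ _ _ hrival).trans ?_
    rw [nsmul_eq_mul]
    gcongr
    exact Finset.card_le_univ _
  have htotal := Finset.add_sum_erase Finset.univ (softmax u) (Finset.mem_univ i)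
  rw [sum_softmax] at htotal
  linarith

theorem inv_card_mul_le_softmax_sub (hz : 0 ≤ z) (hmax : ∀ k, u k ≤ u i) (h : z ≤ u i - u j) :
    (Fintype.card ι : ℝ)⁻¹ * (z / (1 + z)) ≤ softmax u i - softmax u j := by
  have hexp : Real.exp (-z) ≤ 1 / (1 + z) := by
    rw [Real.exp_neg, ← one_div]
    exact one_div_le_one_div_of_le (by positivity) (by linarith [Real.add_one_le_exp z])
  calc (Fintype.card ι : ℝ)⁻¹ * (z / (1 + z))
      ≤ softmax u i * (z / (1 + z)) := by
        gcongr
        exact inv_card_le_softmax hmax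
    _ = softmax u i - softmax u i * (1 / (1 + z)) := by field_simp; ring
    _ ≤ softmax u i - softmax u i * Real.exp (-z) := by
        gcongr
        exact (softmax_pos u i).le
    _ ≤ softmax u i - softmax u j := by
        gcongr
        exact softmax_le_mul_exp_neg h

theorem hasDerivAt_softmax_update [DecidableEq ι] (u : ι → ℝ) (i : ι) :
    HasDerivAt (fun x => softmax (Function.update u i x) i) (softmax u i * (1 - softmax u i))
      (u i) := by
  have : Nonempty ι := ⟨i⟩
  have hexp : ∀ k, HasDerivAt (fun x => Real.exp (Function.update u i x k))
      (Real.exp (u k) * (Pi.single i 1 : ι → ℝ) k) (u i) := fun k => by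
    simpa using (hasDerivAt_pi.1 (hasDerivAt_update u i (u i)) k).exp
  have hpos := sum_exp_pos u
  refine ((hexp i).fun_div (HasDerivAt.fun_sum fun k _ => hexp k) ?_).congr_deriv ?_
  · simpa using hpos.ne'
  · simp only [softmax, Function.update_eq_self, Pi.single_apply, mul_ite, mul_one, mul_zero,
      Finset.sum_ite_eq', Finset.mem_univ, if_true]
    field_simp

end Softmax

namespace StreamingMarket

section Static

variable {N : ℕ} {mkt : StreamingMarket N} {β ε : ℝ} {q n : Fin N → ℝ} {i j : Fin N}

theorem choiceProb_eq_softmax (mkt : StreamingMarket N) (β : ℝ) (q n : Fin N → ℝ) (i : Fin N) :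
    mkt.choiceProb β q n i = softmax (mkt.utility β q n) i :=
  rfl

theorem utility_update (mkt : StreamingMarket N) (β : ℝ) (q n : Fin N → ℝ) (i : Fin N) (x : ℝ) :
    mkt.utility β (Function.update q i x) n =
      Function.update (mkt.utility β q n) i (mkt.α i * x - mkt.p i + β * n i) := by
  ext k
  rcases eq_or_ne k i with rfl | hk
  · simp [utility]
  · simp [utility, hk]

theorem marginalAudience_eq (mkt : StreamingMarket N) (β : ℝ) (q n : Fin N → ℝ) (i : Fin N) :
    mkt.marginalAudience β q n i =
      mkt.M * (mkt.choiceProb β q n i * (1 - mkt.choiceProb β q n i) * mkt.α i) := by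
  have hutility : HasDerivAt (fun x => mkt.α i * x - mkt.p i + β * n i) (mkt.α i) (q i) := by
    simpa using (((hasDerivAt_id (q i)).const_mul (mkt.α i)).sub_const (mkt.p i)).add_const
      (β * n i)
  simp only [marginalAudience, choiceProb_eq_softmax, utility_update]
  exact (((hasDerivAt_softmax_update (mkt.utility β q n) i).comp (q i) hutility).const_mul
    mkt.M).deriv

/-- Right-hand side of the quality equation of streamer `i`. -/
noncomputable def qualityDrift (mkt : StreamingMarket N) (β : ℝ) (q n : Fin N → ℝ) (i : Fin N) :
    ℝ :=
  mkt.η i * ((1 - mkt.τ) * mkt.R * mkt.marginalAudience β q n i - deriv mkt.c (q i))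

theorem qualityDrift_le_qualityDrift (hα : mkt.α i = mkt.α j) (hη : mkt.η i = mkt.η j)
    (hi : q i ∈ mkt.Q) (hj : q j ∈ mkt.Q) (hq : q i ≤ q j)
    (hu : mkt.utility β q n j ≤ mkt.utility β q n i) :
    mkt.qualityDrift β q n j ≤ mkt.qualityDrift β q n i := by
  have hcost : deriv mkt.c (q i) ≤ deriv mkt.c (q j) :=
    mkt.c_convex.monotoneOn_deriv mkt.c_differentiable hi hj hq
  have hmarginal : mkt.marginalAudience β q n j ≤ mkt.marginalAudience β q n i := by
    rw [marginalAudience_eq, marginalAudience_eq, hα]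
    exact mul_le_mul_of_nonneg_left
      (mul_le_mul_of_nonneg_right (softmax_mul_one_sub_le hu) (mkt.α_pos j).le) mkt.M_pos.le
  have hrevenue : 0 ≤ (1 - mkt.τ) * mkt.R :=
    mul_nonneg (sub_nonneg.2 mkt.τ_le_one) mkt.R_pos.le
  rw [qualityDrift, qualityDrift, hη]
  exact mul_le_mul_of_nonneg_left
    (sub_le_sub (mul_le_mul_of_nonneg_left hmarginal hrevenue) hcost) (mkt.η_pos j).le

/-- Streamer `i` has a head start on `j` at qualities `q` and audiences `n`: both respond alike to
quality, and `i` has the strictly larger audience at no lower quality and no higher price. Unlike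
`n j < n i` alone, this persists in time for streamers which are not identical. -/
structure HeadStart (mkt : StreamingMarket N) (q n : Fin N → ℝ) (i j : Fin N) : Prop where
  α_eq : mkt.α i = mkt.α j
  η_eq : mkt.η i = mkt.η j
  price_le : mkt.p i ≤ mkt.p j
  quality_le : q j ≤ q i
  audience_lt : n j < n i

theorem Identical.headStart_iff (hid : mkt.Identical) (hq : q i = q j) :
    mkt.HeadStart q n i j ↔ n j < n i :=
  ⟨HeadStart.audience_lt, fun hn => ⟨hid.1 i j, hid.2.2 i j, (hid.2.1 i j).le, hq.ge, hn⟩⟩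

theorem exists_forall_headStart [Nonempty (Fin N)]
    (h : ∀ i j, i ≠ j → mkt.HeadStart q n i j ∨ mkt.HeadStart q n j i) :
    ∃ i, ∀ j, j ≠ i → mkt.HeadStart q n i j := by
  obtain ⟨i, hi⟩ := Finite.exists_max n
  exact ⟨i, fun j hj => (h i j hj.symm).resolve_right fun hji => (hi j).not_gt hji.audience_lt⟩

theorem HeadStart.mul_audience_sub_le_utility_sub (h : mkt.HeadStart q n i j) (β : ℝ) :
    β * (n i - n j) ≤ mkt.utility β q n i - mkt.utility β q n j := by
  have hquality := mul_nonneg (mkt.α_pos j).le (sub_nonneg.2 h.quality_le)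
  simp only [utility, h.α_eq]
  linarith [h.price_le]

theorem HeadStart.utility_lt (h : mkt.HeadStart q n i j) (hβ : 0 < β) :
    mkt.utility β q n j < mkt.utility β q n i :=
  sub_pos.1 ((mul_pos hβ (sub_pos.2 h.audience_lt)).trans_le (h.mul_audience_sub_le_utility_sub β))

theorem networkEffect_pos (i : Fin N) (hβ : 6 * N / mkt.M ≤ β) : 0 < β := by
  have hM := mkt.M_pos
  have hN : (0 : ℝ) < N := Nat.cast_pos.2 (Fin.pos i)
  exact lt_of_lt_of_le (by positivity) hβ

/-- The gap `x = n i - n j` solves `x' = γ (M (P_i - P_j) - x)`, so `3 / 2` means growth at rate at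
least `γ / 2`. -/
theorem audience_sub_le_choiceProb_sub (hβ : 6 * N / mkt.M ≤ β)
    (h : ∀ k, k ≠ i → mkt.HeadStart q n i k) (hji : j ≠ i)
    (hgap : n i - n j < mkt.M / (2 * N)) :
    3 / 2 * (n i - n j) ≤ mkt.M * (mkt.choiceProb β q n i - mkt.choiceProb β q n j) := by
  have hM := mkt.M_pos
  have hN : (0 : ℝ) < N := Nat.cast_pos.2 (Fin.pos i)
  have hβ0 := networkEffect_pos i hβ
  have hx : 0 < n i - n j := sub_pos.2 (h j hji).audience_lt
  have hmax : ∀ k, mkt.utility β q n k ≤ mkt.utility β q n i := fun k => by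
    rcases eq_or_ne k i with rfl | hk
    · rfl
    · exact ((h k hk).utility_lt hβ0).le
  have hsoftmax := inv_card_mul_le_softmax_sub (mul_pos hβ0 hx).le hmax
    ((h j hji).mul_audience_sub_le_utility_sub β)
  rw [Fintype.card_fin] at hsoftmax
  generalize n i - n j = x at hx hgap hsoftmax ⊢
  calc 3 / 2 * x ≤ β * mkt.M / (N * (1 + β * x)) * x := by
        refine mul_le_mul_of_nonneg_right ?_ hx.le
        have hβM : 6 * N ≤ β * mkt.M := (div_le_iff₀ hM).1 hβ
        have hβx : β * (x * (2 * N)) ≤ β * mkt.M :=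
          mul_le_mul_of_nonneg_left ((lt_div_iff₀ (by positivity)).1 hgap).le hβ0.le
        rw [le_div_iff₀ (by positivity)]
        linarith
    _ = mkt.M * ((N : ℝ)⁻¹ * (β * x / (1 + β * x))) := by field_simp
    _ ≤ _ := mul_le_mul_of_nonneg_left hsoftmax hM.le

theorem sum_share (hsum : ∑ k, n k = mkt.M) : ∑ k, mkt.share n k = 1 := by
  simp only [share]
  rw [← Finset.sum_div, hsum, div_self mkt.M_pos.ne']

theorem dominates_of_lt_audience (hnonneg : ∀ k, 0 ≤ n k) (hsum : ∑ k, n k = mkt.M)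
    (hi : mkt.M * (1 - ε / 2) < n i) : mkt.Dominates ε n i := by
  have hM := mkt.M_pos
  have hshare : ∀ k, 0 ≤ mkt.share n k := fun k => div_nonneg (hnonneg k) hM.le
  have hle : ∀ k, mkt.share n k ≤ 1 := fun k => by
    rw [← sum_share hsum]
    exact Finset.single_le_sum (fun l _ => hshare l) (Finset.mem_univ k)
  have hlt : 1 - ε / 2 < mkt.share n i := by
    rw [share, lt_div_iff₀' hM]
    exact hi
  refine ⟨?_, fun j hj => ?_, ?_⟩
  · rw [abs_lt]
    constructor <;> linarith [hle i]
  · have hpair : mkt.share n i + mkt.share n j ≤ 1 := by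
      rw [← sum_share hsum]
      exact Finset.add_le_sum (fun k _ => hshare k) (Finset.mem_univ i) (Finset.mem_univ j) hj.symm
    rw [abs_of_nonneg (hshare j)]
    linarith [hle i]
  · have hupper : mkt.hhi n ≤ 1 := by
      rw [← sum_share hsum]
      exact Finset.sum_le_sum fun k _ => pow_le_of_le_one (hshare k) (hle k) two_ne_zero
    have hlower : mkt.share n i ^ 2 ≤ mkt.hhi n :=
      Finset.single_le_sum (f := fun k => mkt.share n k ^ 2) (fun k _ => sq_nonneg _)
        (Finset.mem_univ i)
    rw [abs_lt]
    constructor <;> nlinarith [hle i, sq_nonneg (mkt.share n i - 1)]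

theorem eventually_ge_and_mul_exp_neg_le (mkt : StreamingMarket N) {δ : ℝ} (hδ : 0 < δ) :
    ∀ᶠ β : ℝ in atTop,
      6 * N / mkt.M ≤ β ∧ N * Real.exp (-(β * (mkt.M / (2 * N)))) ≤ δ := by
  refine (eventually_ge_atTop _).and ?_
  rcases N.eq_zero_or_pos with rfl | hN
  · simp [hδ.le]
  have hgap : 0 < mkt.M / (2 * N) := by
    have := mkt.M_pos
    positivity
  have hlim := (Real.tendsto_exp_neg_atTop_nhds_zero.comp
    (tendsto_id.atTop_mul_const hgap)).const_mul (N : ℝ)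
  rw [mul_zero] at hlim
  exact hlim.eventually_le_const hδ

end Static

namespace IsTrajectory

variable {N : ℕ} {mkt : StreamingMarket N} {β ε : ℝ} {n q : ℝ → Fin N → ℝ} {i j : Fin N} {t : ℝ}

theorem nonempty_fin (h : mkt.IsTrajectory β n q) : Nonempty (Fin N) := by
  by_contra hempty
  rw [not_nonempty_iff] at hempty
  exact mkt.M_pos.ne ((Fintype.sum_empty _).symm.trans h.initial_sum)

theorem continuousOn_audience (h : mkt.IsTrajectory β n q) (i : Fin N) :
    ContinuousOn (fun s => n s i) (Ici 0) :=
  fun s hs => (h.viewer_eq s hs i).continuousWithinAt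

theorem continuousOn_quality (h : mkt.IsTrajectory β n q) (i : Fin N) :
    ContinuousOn (fun s => q s i) (Ici 0) :=
  fun s hs => (h.quality_eq s hs i).continuousWithinAt

theorem continuousOn_utility (h : mkt.IsTrajectory β n q) (i : Fin N) :
    ContinuousOn (fun s => mkt.utility β (q s) (n s) i) (Ici 0) :=
  (((h.continuousOn_quality i).const_mul _).sub continuousOn_const).add
    ((h.continuousOn_audience i).const_mul β)

theorem hasDerivWithinAt_audience (h : mkt.IsTrajectory β n q) (i : Fin N) (ht : 0 ≤ t) :
    HasDerivWithinAt (fun s => n s i)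
      (mkt.γ * (mkt.M * mkt.choiceProb β (q t) (n t) i - n t i)) (Ici t) t :=
  (h.viewer_eq t ht i).mono (Ici_subset_Ici.2 ht)

theorem hasDerivWithinAt_quality (h : mkt.IsTrajectory β n q) (i : Fin N) (ht : 0 ≤ t) :
    HasDerivWithinAt (fun s => q s i) (mkt.qualityDrift β (q t) (n t) i) (Ici t) t :=
  (h.quality_eq t ht i).mono (Ici_subset_Ici.2 ht)

theorem hasDerivWithinAt_audience_sub (h : mkt.IsTrajectory β n q) (i j : Fin N) (ht : 0 ≤ t) :
    HasDerivWithinAt (fun s => n s i - n s j)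
      (mkt.γ * (mkt.M * (mkt.choiceProb β (q t) (n t) i - mkt.choiceProb β (q t) (n t) j)
        - (n t i - n t j))) (Ici t) t :=
  ((h.hasDerivWithinAt_audience i ht).fun_sub (h.hasDerivWithinAt_audience j ht)).congr_deriv
    (by ring)

theorem audience_nonneg (h : mkt.IsTrajectory β n q) (i : Fin N) (ht : 0 ≤ t) : 0 ≤ n t i := by
  have hdecay := mul_exp_le_of_mul_le_deriv_right (κ := -mkt.γ)
    ((h.continuousOn_audience i).mono Icc_subset_Ici_self)
    (fun s hs => h.hasDerivWithinAt_audience i hs.1) (fun s _ => by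
      have := mul_pos mkt.γ_pos (mul_pos mkt.M_pos (softmax_pos (mkt.utility β (q s) (n s)) i))
      rw [choiceProb_eq_softmax]
      linarith) t (right_mem_Icc.2 ht)
  exact (mul_nonneg (h.initial_nonneg i) (Real.exp_pos _).le).trans hdecay

theorem hasDerivWithinAt_sum_audience_sub (h : mkt.IsTrajectory β n q) (ht : 0 ≤ t) :
    HasDerivWithinAt (fun s => ∑ k, n s k - mkt.M) (-mkt.γ * (∑ k, n t k - mkt.M)) (Ici t) t := by
  have := h.nonempty_fin
  refine ((HasDerivWithinAt.fun_sum fun k _ => h.hasDerivWithinAt_audience k ht).sub_const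
    mkt.M).congr_deriv ?_
  simp only [choiceProb_eq_softmax]
  rw [← Finset.mul_sum, Finset.sum_sub_distrib, ← Finset.mul_sum, sum_softmax]
  ring

theorem sum_audience (h : mkt.IsTrajectory β n q) (ht : 0 ≤ t) : ∑ k, n t k = mkt.M := by
  have hcont : ContinuousOn (fun s => ∑ k, n s k - mkt.M) (Icc 0 t) :=
    ((continuousOn_finsetSum _ fun k _ => h.continuousOn_audience k).sub
      continuousOn_const).mono Icc_subset_Ici_self
  have hlower := mul_exp_le_of_mul_le_deriv_right hcont
    (fun s hs => h.hasDerivWithinAt_sum_audience_sub hs.1) (fun _ _ => le_rfl) t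
    (right_mem_Icc.2 ht)
  have hupper := mul_exp_le_of_mul_le_deriv_right hcont.neg
    (fun s hs => (h.hasDerivWithinAt_sum_audience_sub hs.1).neg) (fun s _ => (mul_neg _ _).le) t
    (right_mem_Icc.2 ht)
  simp only [Pi.neg_apply, h.initial_sum, sub_self, neg_zero, zero_mul] at hlower hupper
  linarith

theorem audience_lt_of_utility_le_before (h : mkt.IsTrajectory β n q) (h₀ : n 0 j < n 0 i)
    (ht : 0 ≤ t) (hu : ∀ s ∈ Ico 0 t, mkt.utility β (q s) (n s) j ≤ mkt.utility β (q s) (n s) i) :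
    n t j < n t i := by
  have hdecay := mul_exp_le_of_mul_le_deriv_right (κ := -mkt.γ)
    (((h.continuousOn_audience i).fun_sub (h.continuousOn_audience j)).mono Icc_subset_Ici_self)
    (fun s hs => h.hasDerivWithinAt_audience_sub i j hs.1) (fun s hs => by
      have := mul_nonneg mkt.γ_pos.le
        (mul_nonneg mkt.M_pos.le (sub_nonneg.2 (softmax_le_softmax (hu s hs))))
      simp only [choiceProb_eq_softmax]
      linarith) t (right_mem_Icc.2 ht)
  exact sub_pos.1 ((mul_pos (sub_pos.2 h₀) (Real.exp_pos _)).trans_le hdecay)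

theorem quality_le_of_utility_le_before (h : mkt.IsTrajectory β n q) (hα : mkt.α i = mkt.α j)
    (hη : mkt.η i = mkt.η j) (h₀ : q 0 j ≤ q 0 i) (ht : 0 ≤ t)
    (hu : ∀ s ∈ Ico 0 t, mkt.utility β (q s) (n s) j ≤ mkt.utility β (q s) (n s) i) :
    q t j ≤ q t i := by
  refine sub_nonneg.1 (nonneg_of_deriv_right_nonneg_of_neg
    (((h.continuousOn_quality i).sub (h.continuousOn_quality j)).mono Icc_subset_Ici_self)
    (fun s hs => (h.hasDerivWithinAt_quality i hs.1).sub (h.hasDerivWithinAt_quality j hs.1))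
    (sub_nonneg.2 h₀) (fun s hs hneg => ?_) t (right_mem_Icc.2 ht))
  exact sub_nonneg.2 (qualityDrift_le_qualityDrift hα hη (h.quality_mem s hs.1 i)
    (h.quality_mem s hs.1 j) (sub_neg.1 hneg).le (hu s hs))

theorem headStart_persists (h : mkt.IsTrajectory β n q) (hβ : 0 < β)
    (h₀ : mkt.HeadStart (q 0) (n 0) i j) (ht : 0 ≤ t) : mkt.HeadStart (q t) (n t) i j := by
  have hpersists : ∀ T, 0 ≤ T →
      (∀ s ∈ Ico 0 T, mkt.utility β (q s) (n s) j ≤ mkt.utility β (q s) (n s) i) →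
      mkt.HeadStart (q T) (n T) i j := fun T hT hu =>
    { h₀ with
      quality_le := h.quality_le_of_utility_le_before h₀.α_eq h₀.η_eq h₀.quality_le hT hu
      audience_lt := h.audience_lt_of_utility_le_before h₀.audience_lt hT hu }
  have hutility := pos_of_forall_pos_before
    (((h.continuousOn_utility i).sub (h.continuousOn_utility j)).mono
      (Icc_subset_Ici_self : Icc 0 t ⊆ Ici 0))
    fun T hT hbefore => sub_pos.2
      ((hpersists T hT.1 fun s hs => (sub_pos.1 (hbefore s hs)).le).utility_lt hβ)
  exact hpersists t ht fun s hs => (sub_pos.1 (hutility s (Ico_subset_Icc_self hs))).le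

theorem eventually_le_audience_sub (h : mkt.IsTrajectory β n q) (hβ : 6 * N / mkt.M ≤ β)
    (h₀ : ∀ k, k ≠ i → mkt.HeadStart (q 0) (n 0) i k) (hji : j ≠ i) :
    ∀ᶠ t in atTop, mkt.M / (2 * N) ≤ n t i - n t j := by
  have hβ0 := networkEffect_pos i hβ
  have hlead : ∀ s, 0 ≤ s → ∀ k, k ≠ i → mkt.HeadStart (q s) (n s) i k :=
    fun s hs k hk => h.headStart_persists hβ0 (h₀ k hk) hs
  refine eventually_ge_of_exponential_growth_below (κ := mkt.γ / 2)
    ((h.continuousOn_audience i).fun_sub (h.continuousOn_audience j))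
    (fun s hs => h.hasDerivWithinAt_audience_sub i j hs) (half_pos mkt.γ_pos)
    (fun s hs => sub_pos.2 (hlead s hs j hji).audience_lt) fun s hs hgap => ?_
  have := mul_le_mul_of_nonneg_left
    (audience_sub_le_choiceProb_sub hβ (hlead s hs) hji hgap) mkt.γ_pos.le
  linarith

theorem eventually_le_choiceProb (h : mkt.IsTrajectory β n q) (hβ : 6 * N / mkt.M ≤ β)
    (h₀ : ∀ k, k ≠ i → mkt.HeadStart (q 0) (n 0) i k) :
    ∀ᶠ t in atTop,
      1 - N * Real.exp (-(β * (mkt.M / (2 * N)))) ≤ mkt.choiceProb β (q t) (n t) i := by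
  have hβ0 := networkEffect_pos i hβ
  have hgap : ∀ᶠ t in atTop, ∀ k, k ≠ i → mkt.M / (2 * N) ≤ n t i - n t k := by
    simp only [eventually_all]
    exact fun k hk => h.eventually_le_audience_sub hβ h₀ hk
  filter_upwards [hgap, eventually_ge_atTop 0] with s hgap_s hs
  have hsoftmax := one_sub_card_mul_exp_neg_le_softmax (u := mkt.utility β (q s) (n s))
    fun k hk => (mul_le_mul_of_nonneg_left (hgap_s k hk) hβ0.le).trans
      ((h.headStart_persists hβ0 (h₀ k hk) hs).mul_audience_sub_le_utility_sub β)
  rwa [Fintype.card_fin] at hsoftmax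

theorem eventually_dominates (h : mkt.IsTrajectory β n q) (hε : 0 < ε)
    (hβ : 6 * N / mkt.M ≤ β) (hβε : N * Real.exp (-(β * (mkt.M / (2 * N)))) ≤ ε / 4)
    (h₀ : ∀ k, k ≠ i → mkt.HeadStart (q 0) (n 0) i k) :
    ∀ᶠ t in atTop, mkt.Dominates ε (n t) i := by
  have hM := mkt.M_pos
  have hrelax : ∀ᶠ t in atTop, mkt.γ * (mkt.M * (1 - ε / 4) - n t i) ≤
      mkt.γ * (mkt.M * mkt.choiceProb β (q t) (n t) i - n t i) := by
    have hγ := mkt.γ_pos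
    filter_upwards [h.eventually_le_choiceProb hβ h₀] with s hs
    gcongr
    linarith
  have hlevel : mkt.M * (1 - ε / 2) < mkt.M * (1 - ε / 4) :=
    mul_lt_mul_of_pos_left (by linarith) hM
  filter_upwards [eventually_lt_of_relaxation (h.continuousOn_audience i)
    (fun s hs => h.hasDerivWithinAt_audience i hs) mkt.γ_pos hlevel hrelax,
    eventually_ge_atTop 0] with s hlt hs
  exact dominates_of_lt_audience (fun k => h.audience_nonneg k hs) (h.sum_audience hs) hlt

end IsTrajectory

end StreamingMarket

theorem mainTheorem6_general {N : ℕ} (mkt : StreamingMarket N) {ε : ℝ} (hε : 0 < ε) :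
    ∃ β₀ : ℝ, 0 < β₀ ∧ ∀ β : ℝ, β₀ ≤ β →
      (∀ (n q : ℝ → Fin N → ℝ), mkt.IsTrajectory β n q →
        ∀ i, (∀ j, j ≠ i → mkt.HeadStart (q 0) (n 0) i j) →
          ∀ᶠ t in atTop, mkt.Dominates ε (n t) i) ∧
      (∀ (Ω : Type*) [MeasurableSpace Ω] (μ : MeasureTheory.Measure Ω)
        (n q : Ω → ℝ → Fin N → ℝ),
        (∀ᵐ ω ∂μ, mkt.IsTrajectory β (n ω) (q ω)) →
        (∀ i j, i ≠ j → ∀ᵐ ω ∂μ,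
          mkt.HeadStart (q ω 0) (n ω 0) i j ∨ mkt.HeadStart (q ω 0) (n ω 0) j i) →
          ∀ᵐ ω ∂μ, ∃ i, (∀ j, j ≠ i → mkt.HeadStart (q ω 0) (n ω 0) i j) ∧
            ∀ᶠ t in atTop, mkt.Dominates ε (n ω t) i) := by
  obtain ⟨β₀, hβ₀⟩ := ((eventually_gt_atTop (0 : ℝ)).and
    (mkt.eventually_ge_and_mul_exp_neg_le (by positivity : 0 < ε / 4))).exists_forall_of_atTop
  refine ⟨β₀, (hβ₀ β₀ le_rfl).1, fun β hβ => ?_⟩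
  obtain ⟨-, hgrowth, hfinal⟩ := hβ₀ β hβ
  refine ⟨fun n q h i h₀ => h.eventually_dominates hε hgrowth hfinal h₀,
    fun Ω _ μ n q htraj hcomp => ?_⟩
  have hcomp_all : ∀ᵐ ω ∂μ, ∀ i j, i ≠ j →
      mkt.HeadStart (q ω 0) (n ω 0) i j ∨ mkt.HeadStart (q ω 0) (n ω 0) j i := by
    simpa only [MeasureTheory.ae_all_iff] using hcomp
  filter_upwards [htraj, hcomp_all] with ω h hω
  have := h.nonempty_fin
  obtain ⟨i, hi⟩ := StreamingMarket.exists_forall_headStart hω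
  exact ⟨i, hi, h.eventually_dominates hε hgrowth hfinal hi⟩

theorem mainTheorem6 {N : ℕ} (mkt : StreamingMarket N) (hid : mkt.Identical) :
    ∀ ε : ℝ, 0 < ε → ∃ β₀ : ℝ, 0 < β₀ ∧ ∀ β : ℝ, β₀ ≤ β → ∀ q₀ : ℝ,
      -- every initial audience profile with a strict leader `i`
      (∀ (n q : ℝ → Fin N → ℝ), mkt.IsTrajectory β n q → (∀ i, q 0 i = q₀) →
        ∀ i, (∀ j, j ≠ i → n 0 j < n 0 i) →
          ∀ᶠ t in Filter.atTop, mkt.Dominates ε (n t) i) ∧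
      -- random initial audiences, almost surely without ties
      (∀ (Ω : Type*) [MeasurableSpace Ω] (ℙ : MeasureTheory.Measure Ω)
        [MeasureTheory.IsProbabilityMeasure ℙ] (n q : Ω → ℝ → Fin N → ℝ),
        (∀ᵐ ω ∂ℙ, mkt.IsTrajectory β (n ω) (q ω) ∧ ∀ i, q ω 0 i = q₀) →
        (∀ i j, i ≠ j → ∀ᵐ ω ∂ℙ, n ω 0 i ≠ n ω 0 j) →
          ∀ᵐ ω ∂ℙ, ∃ i, (∀ j, j ≠ i → n ω 0 j < n ω 0 i) ∧
            ∀ᶠ t in Filter.atTop, mkt.Dominates ε (n ω t) i) := by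
  intro ε hε
  obtain ⟨β₀, hβ₀, h⟩ := mainTheorem6_general mkt hε
  refine ⟨β₀, hβ₀, fun β hβ q₀ => ⟨fun n q htraj hq i hi => ?_, fun Ω _ ℙ _ n q htraj hties => ?_⟩⟩
  · exact (h β hβ).1 n q htraj i fun j hj => (hid.headStart_iff (by simp only [hq])).2 (hi j hj)
  · have hiff : ∀ᵐ ω ∂ℙ, ∀ i j, mkt.HeadStart (q ω 0) (n ω 0) i j ↔ n ω 0 j < n ω 0 i :=
      htraj.mono fun ω hω i j => hid.headStart_iff (by simp only [hω.2])
    filter_upwards [hiff, (h β hβ).2 Ω ℙ n q (htraj.mono fun ω hω => hω.1) fun i j hij => by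
      filter_upwards [hiff, hties i j hij] with ω hω hne
      simpa only [hω] using hne.symm.lt_or_gt] with ω hω hdominates
    simpa only [hω] using hdominates
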